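/- Let $C\ge 1$, $d \ge 0$, let $T\subseteq\mathbb{R}^d$ be non-empty, and for every $x\in T$ let $\mu(x)\in\mathbb{R}^C$ and let $\Sigma(x)\in\mathbb{R}^{C\times C}$ be symmetric positive definite. Write $\mathcal{N}(z\mid m,V)$ for the Gaussian density with mean $m$ and (co)variance $V$. Let $S=\prod_{i=1}^{C}[k_i^1,k_i^2]$ be an axis-parallel hyper-rectangle, where $k_i^1\le k_i^2$ are real. For $i\in\{1,\dots,C-1\}$ put $\mathcal{I}=\{i+1,\dots,C\}$ and $S^{i+1}=\prod_{j=i+1}^{C}[k_j^1,k_j^2]$, and for $f\in\mathbb{R}^{C-i}$ (with coordinates indexed by $\mathcal{I}$) define $$\mu_i^f(x)=\mu_i(x)+\Sigma_{i,\mathcal{I}}(x)\,\Sigma_{\mathcal{I},\mathcal{I}}(x)^{-1}\,(f-\mu_{\mathcal{I}}(x)),\qquad \Sigma_i^f(x)=\Sigma_{i,i}(x)-\Sigma_{i,\mathcal{I}}(x)\,\Sigma_{\mathcal{I},\mathcal{I}}(x)^{-1}\,\Sigma_{i,\mathcal{I}}(x)^{T}.$$ Then $$\sup_{x\in T}\int_S\mathcal{N}(z\mid\mu(x),\Sigma(x))\,dz\;\le\;\Big(\sup_{x\in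 T}\int_{k_C^1}^{k_C^2}\mathcal{N}(z\mid\mu_C(x),\Sigma_{C,C}(x))\,dz\Big)\prod_{i=1}^{C-1}\;\sup_{x\in T,\ f\in S^{i+1}}\int_{k_i^1}^{k_i^2}\mathcal{N}(z\mid\mu_i^f(x),\Sigma_i^f(x))\,dz,$$ $$\inf_{x\in T}\int_S\mathcal{N}(z\mid\mu(x),\Sigma(x))\,dz\;\ge\;\Big(\inf_{x\in T}\int_{k_C^1}^{k_C^2}\mathcal{N}(z\mid\mu_C(x),\Sigma_{C,C}(x))\,dz\Big)\prod_{i=1}^{C-1}\;\inf_{x\in T,\ f\in S^{i+1}}\int_{k_i^1}^{k_i^2}\mathcal{N}(z\mid\mu_i^f(x),\Sigma_i^f(x))\,dz,$$ where all the integrals lie in $[0,1]$. If moreover $T$ is compact and $\mu$ and $\Sigma$ are continuous on $T$, then all these suprema and infima are attained, i.e. they are maxima and minima. -/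

import Mathlib

open Set MeasureTheory ProbabilityTheory

noncomputable section

/-- The density `N(z | m, V)` of the multivariate Gaussian distribution on `ℝ^ι` with mean `m` and
(positive definite) covariance matrix `V`:
`exp (- (z - m)ᵀ V⁻¹ (z - m) / 2) / √((2π)^|ι| det V)`. -/
def mvGaussianDensity {ι : Type*} [Fintype ι] [DecidableEq ι]
    (m : ι → ℝ) (V : Matrix ι ι ℝ) (z : ι → ℝ) : ℝ :=
  (√((2 * Real.pi) ^ Fintype.card ι * V.det))⁻¹ *
    Real.exp (-((z - m) ⬝ᵥ Matrix.mulVec V⁻¹ (z - m)) / 2)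

/-- The integral over `[a, b]` of the univariate Gaussian density with mean `m` and variance `v`. -/
def gaussianIntervalMass (m v a b : ℝ) : ℝ :=
  ∫ z in a..b, gaussianPDFReal m v.toNNReal z

section Conditioning

variable {C : ℕ}

/-- The coordinates strictly after `i`, that is `i+1, …, C`. -/
abbrev After (i : Fin C) : Type := {j : Fin C // i < j}

/-- The subvector of `m` with the components after `i`. -/
def tailVec (m : Fin C → ℝ) (i : Fin C) : After i → ℝ := fun j => m j

/-- The row `V_{i, i+1:C}`. -/
def tailRow (V : Matrix (Fin C) (Fin C) ℝ) (i : Fin C) : After i → ℝ := fun j => V i j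

/-- The submatrix `V_{i+1:C, i+1:C}`. -/
def tailBlock (V : Matrix (Fin C) (Fin C) ℝ) (i : Fin C) : Matrix (After i) (After i) ℝ :=
  V.submatrix Subtype.val Subtype.val

/-- The conditional mean `m_i + V_{i,I} V_{I,I}⁻¹ (f - m_I)`, with `I = i+1:C`. -/
def condMean (m : Fin C → ℝ) (V : Matrix (Fin C) (Fin C) ℝ) (i : Fin C) (f : After i → ℝ) : ℝ :=
  m i + tailRow V i ⬝ᵥ Matrix.mulVec (tailBlock V i)⁻¹ (f - tailVec m i)

/-- The conditional variance (Schur complement) `V_{i,i} - V_{i,I} V_{I,I}⁻¹ V_{i,I}ᵀ`,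
with `I = i+1:C`. -/
def condVar (V : Matrix (Fin C) (Fin C) ℝ) (i : Fin C) : ℝ :=
  V i i - tailRow V i ⬝ᵥ Matrix.mulVec (tailBlock V i)⁻¹ (tailRow V i)

end Conditioning

section Masses

/-! Throughout, `C = n + 1` is the dimension of the latent space; the coordinates are indexed by
`Fin (n + 1)`, the last one is `Fin.last n`, the others are `i.castSucc` for `i : Fin n`. -/

variable {d n : ℕ}

/-- `∫_S N(z | μ(x), Σ(x)) dz` for the box `S = ∏ i, [a i, b i]`. -/
def boxMass (μ : EuclideanSpace ℝ (Fin d) → Fin (n + 1) → ℝ)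
    (cov : EuclideanSpace ℝ (Fin d) → Matrix (Fin (n + 1)) (Fin (n + 1)) ℝ)
    (a b : Fin (n + 1) → ℝ) (x : EuclideanSpace ℝ (Fin d)) : ℝ :=
  ∫ z in Icc a b, mvGaussianDensity (μ x) (cov x) z

/-- `∫_{[a_C, b_C]} N(z | μ_C(x), Σ_{C,C}(x)) dz`, for the last coordinate. -/
def lastMass (μ : EuclideanSpace ℝ (Fin d) → Fin (n + 1) → ℝ)
    (cov : EuclideanSpace ℝ (Fin d) → Matrix (Fin (n + 1)) (Fin (n + 1)) ℝ)
    (a b : Fin (n + 1) → ℝ) (x : EuclideanSpace ℝ (Fin d)) : ℝ :=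
  gaussianIntervalMass (μ x (Fin.last n)) (cov x (Fin.last n) (Fin.last n))
    (a (Fin.last n)) (b (Fin.last n))

/-- `∫_{[a_i, b_i]} N(z | μ_i^f(x), Σ_i^f(x)) dz`, as a function of the pair `(x, f)`. -/
def condMass (μ : EuclideanSpace ℝ (Fin d) → Fin (n + 1) → ℝ)
    (cov : EuclideanSpace ℝ (Fin d) → Matrix (Fin (n + 1)) (Fin (n + 1)) ℝ)
    (a b : Fin (n + 1) → ℝ) (i : Fin (n + 1))
    (p : EuclideanSpace ℝ (Fin d) × (After i → ℝ)) : ℝ :=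
  gaussianIntervalMass (condMean (μ p.1) (cov p.1) i p.2) (condVar (cov p.1) i) (a i) (b i)

/-- The box `S^{i+1} = ∏_{j > i} [a j, b j]` of the coordinates after `i`. -/
def tailBox (a b : Fin (n + 1) → ℝ) (i : Fin (n + 1)) : Set (After i → ℝ) :=
  Icc (tailVec a i) (tailVec b i)

end Masses

end

open Matrix

/-! The proof is the chain rule for densities. A Gaussian density factors as the conditional density
of coordinate `0` given the others, times the density of the others (`mvGaussianDensity_eq_mul`). By
Fubini the mass of a box is the integral, over the tail box, of the conditional mass of coordinate
`0` against the nonnegative tail density (`integral_gaussianIntervalMass_mul`). Bounding that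
conditional mass by constants and inducting on the tail, whose conditional means and variances are
those of the full vector, gives the bound for a single `x`
(`setIntegral_mvGaussianDensity_mem_Icc`). The constants are then taken to be the extrema over all
`(x, f)`. Attainment is continuity on compact sets. -/

/-! ### Schur complements. -/

theorem dotProduct_inv_submatrix_mulVec_comp {ι κ : Type*} [Fintype ι] [DecidableEq ι] [Fintype κ]
    [DecidableEq κ] (A : Matrix ι ι ℝ) (e : κ ≃ ι) (r u : ι → ℝ) :
    (r ∘ e) ⬝ᵥ ((A.submatrix e e)⁻¹ *ᵥ (u ∘ e)) = r ⬝ᵥ (A⁻¹ *ᵥ u) := by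
  rw [inv_submatrix_equiv, submatrix_mulVec_equiv, comp_equiv_dotProduct_comp_equiv]
  simp [Function.comp_assoc]

/-- Block determinant formula. An arbitrary injective `g` serves both the positivity of `condVar`
and the factorisation of `V.det`. -/
theorem det_submatrix_sumElim {ι κ : Type*} [Fintype κ] [DecidableEq κ]
    {V : Matrix ι ι ℝ} (hV : V.PosDef) (i : ι) {g : κ → ι} (hg : Function.Injective g) :
    (V.submatrix (Sum.elim (fun _ : Unit => i) g) (Sum.elim (fun _ : Unit => i) g)).det =
      (V.submatrix g g).det *
        (V i i - (fun j => V i (g j)) ⬝ᵥ ((V.submatrix g g)⁻¹ *ᵥ fun j => V i (g j))) := by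
  have hdet : IsUnit (V.submatrix g g).det := (hV.submatrix hg).det_pos.ne'.isUnit
  let _ := Matrix.invertibleOfIsUnitDet _ hdet
  have hsymm : ∀ j, V (g j) i = V i (g j) := fun j => by
    simpa using hV.isHermitian.apply i (g j)
  have h : V.submatrix (Sum.elim (fun _ : Unit => i) g) (Sum.elim (fun _ : Unit => i) g) =
      fromBlocks (Matrix.of fun _ _ => V i i) (Matrix.of fun _ j => V i (g j))
        (Matrix.of fun j _ => V i (g j)) (V.submatrix g g) := by
    ext (a | a) (b | b) <;> simp [hsymm]
  rw [h, det_fromBlocks₂₂, invOf_eq_nonsing_inv]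
  congr 1
  rw [det_unique, Matrix.sub_apply, Matrix.mul_assoc]
  rfl

/-- The conditional variance is a quotient of two principal minors of `V`, both positive. -/
theorem condVar_pos {C : ℕ} {V : Matrix (Fin C) (Fin C) ℝ} (hV : V.PosDef) (i : Fin C) :
    0 < condVar V i := by
  have hval : Function.Injective (Subtype.val : After i → Fin C) := Subtype.val_injective
  have hinj : Function.Injective (Sum.elim (fun _ : Unit => i) (Subtype.val : After i → Fin C)) := by
    rintro (a | a) (b | b) h
    · rfl
    · exact absurd h b.2.ne
    · exact absurd h.symm a.2.ne
    · exact congrArg _ (Subtype.ext h)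
  have h := (hV.submatrix hinj).det_pos
  rw [det_submatrix_sumElim hV i hval] at h
  exact pos_of_mul_pos_right h (hV.submatrix hval).det_pos.le

/-! ### Splitting off the first coordinate. -/

section Reindex

variable {n : ℕ}

/-- The coordinates after `0` are the successors. -/
def afterZeroEquiv (n : ℕ) : Fin n ≃ After (0 : Fin (n + 1)) where
  toFun j := ⟨j.succ, j.succ_pos⟩
  invFun j := j.1.pred j.2.ne'
  left_inv j := by simp
  right_inv j := by simp

/-- The coordinates after `i.succ` are the successors of the coordinates after `i`. -/
def afterSuccEquiv (i : Fin n) : After i ≃ After i.succ where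
  toFun j := ⟨j.1.succ, Fin.succ_lt_succ_iff.2 j.2⟩
  invFun j := ⟨j.1.pred (Fin.ne_zero_of_lt j.2), by
    have h := j.2
    rw [← Fin.succ_lt_succ_iff, Fin.succ_pred]
    exact h⟩
  left_inv j := by simp
  right_inv j := by simp

theorem condMean_zero_eq (m : Fin (n + 1) → ℝ) (V : Matrix (Fin (n + 1)) (Fin (n + 1)) ℝ)
    (f : After (0 : Fin (n + 1)) → ℝ) :
    condMean m V 0 f = m 0 + (fun j => V 0 (Fin.succ j)) ⬝ᵥ
      ((V.submatrix Fin.succ Fin.succ)⁻¹ *ᵥ (f ∘ afterZeroEquiv n - m ∘ Fin.succ)) := by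
  rw [condMean, ← dotProduct_inv_submatrix_mulVec_comp _ (afterZeroEquiv n)]
  rfl

theorem condVar_zero_eq (V : Matrix (Fin (n + 1)) (Fin (n + 1)) ℝ) :
    condVar V 0 = V 0 0 - (fun j => V 0 (Fin.succ j)) ⬝ᵥ
      ((V.submatrix Fin.succ Fin.succ)⁻¹ *ᵥ (fun j => V 0 (Fin.succ j))) := by
  rw [_root_.condVar, ← dotProduct_inv_submatrix_mulVec_comp _ (afterZeroEquiv n)]
  rfl

/-- Coordinate `0` never enters the conditioning of a later coordinate; this is what lets the
induction pass to the tail. -/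
theorem condMean_succ (m : Fin (n + 1) → ℝ) (V : Matrix (Fin (n + 1)) (Fin (n + 1)) ℝ)
    (i : Fin n) (f : After i.succ → ℝ) :
    condMean m V i.succ f =
      condMean (m ∘ Fin.succ) (V.submatrix Fin.succ Fin.succ) i (f ∘ afterSuccEquiv i) := by
  rw [condMean, ← dotProduct_inv_submatrix_mulVec_comp _ (afterSuccEquiv i)]
  rfl

theorem condVar_succ (V : Matrix (Fin (n + 1)) (Fin (n + 1)) ℝ) (i : Fin n) :
    condVar V i.succ = condVar (V.submatrix Fin.succ Fin.succ) i := by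
  rw [_root_.condVar, ← dotProduct_inv_submatrix_mulVec_comp _ (afterSuccEquiv i)]
  rfl

theorem det_eq_det_submatrix_succ_mul_condVar {V : Matrix (Fin (n + 1)) (Fin (n + 1)) ℝ}
    (hV : V.PosDef) :
    V.det = (V.submatrix Fin.succ Fin.succ).det * condVar V 0 := by
  have hb : Function.Bijective
      (Sum.elim (fun _ : Unit => (0 : Fin (n + 1))) (Fin.succ : Fin n → Fin (n + 1))) := by
    constructor
    · rintro (a | a) (b | b) h
      · rfl
      · exact absurd h (Fin.succ_ne_zero b).symm
      · exact absurd h (Fin.succ_ne_zero a)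
      · exact congrArg _ (Fin.succ_injective _ h)
    · refine Fin.cases ⟨Sum.inl (), rfl⟩ fun j => ⟨Sum.inr j, rfl⟩
  rw [condVar_zero_eq, ← det_submatrix_sumElim hV 0 (Fin.succ_injective n)]
  exact (det_submatrix_equiv_self (Equiv.ofBijective _ hb) V).symm

/-- Completion of the square, obtained by solving `V y = u` blockwise. -/
theorem dotProduct_inv_mulVec_eq_add {V : Matrix (Fin (n + 1)) (Fin (n + 1)) ℝ}
    (hV : V.PosDef) (u : Fin (n + 1) → ℝ) :
    u ⬝ᵥ (V⁻¹ *ᵥ u) =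
      (u 0 - (fun j => V 0 (Fin.succ j)) ⬝ᵥ
        ((V.submatrix Fin.succ Fin.succ)⁻¹ *ᵥ (u ∘ Fin.succ))) ^ 2 / condVar V 0 +
      (u ∘ Fin.succ) ⬝ᵥ ((V.submatrix Fin.succ Fin.succ)⁻¹ *ᵥ (u ∘ Fin.succ)) := by
  have hs := (condVar_pos hV 0).ne'
  have hs' := condVar_zero_eq V
  have hA := hV.submatrix (Fin.succ_injective n)
  have hVs : ∀ j : Fin n, V j.succ 0 = V 0 j.succ := fun j => by
    simpa using hV.isHermitian.apply 0 j.succ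
  set A := V.submatrix Fin.succ Fin.succ with hAdef
  set r : Fin n → ℝ := fun j => V 0 j.succ with hr
  set w : Fin n → ℝ := u ∘ Fin.succ with hw
  have hAdet : IsUnit A.det := hA.det_pos.ne'.isUnit
  have hAinv : ∀ v, A *ᵥ (A⁻¹ *ᵥ v) = v := fun v => by
    rw [mulVec_mulVec, mul_nonsing_inv _ hAdet, one_mulVec]
  have hsymm : w ⬝ᵥ (A⁻¹ *ᵥ r) = r ⬝ᵥ (A⁻¹ *ᵥ w) := by
    have hT : (A⁻¹)ᵀ = A⁻¹ := by
      simpa using hA.isHermitian.inv.eq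
    rw [dotProduct_mulVec, ← mulVec_transpose, hT, dotProduct_comm]
  -- The tail rows of `V y = u` force `y` to have tail `A⁻¹ (w - t r)`, where `t` is its first
  -- entry; the first row then determines `t`.
  set t : ℝ := (u 0 - r ⬝ᵥ (A⁻¹ *ᵥ w)) / condVar V 0 with ht
  have hts : t * condVar V 0 = u 0 - r ⬝ᵥ (A⁻¹ *ᵥ w) := div_mul_cancel₀ _ hs
  have hy : V⁻¹ *ᵥ u = vecCons t (A⁻¹ *ᵥ w - t • (A⁻¹ *ᵥ r)) := by
    let _ := Matrix.invertibleOfIsUnitDet V hV.det_pos.ne'.isUnit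
    apply inv_mulVec_eq_vec
    ext j
    refine Fin.cases ?_ (fun j => ?_) j
    · have : (V *ᵥ vecCons t (A⁻¹ *ᵥ w - t • (A⁻¹ *ᵥ r))) 0 =
          V 0 0 * t + r ⬝ᵥ (A⁻¹ *ᵥ w - t • (A⁻¹ *ᵥ r)) := by
        simp [mulVec, dotProduct, Fin.sum_univ_succ, hr]
      rw [this, dotProduct_sub, dotProduct_smul, smul_eq_mul]
      rw [hs'] at hts
      linarith
    · have : (V *ᵥ vecCons t (A⁻¹ *ᵥ w - t • (A⁻¹ *ᵥ r))) j.succ =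
          r j * t + (A *ᵥ (A⁻¹ *ᵥ w - t • (A⁻¹ *ᵥ r))) j := by
        rw [mulVec, dotProduct, Fin.sum_univ_succ]
        simp [mulVec, dotProduct, hr, hVs, hAdef]
      rw [this, mulVec_sub, mulVec_smul, hAinv, hAinv]
      simp [hw]
      ring
  have hsplit : u ⬝ᵥ vecCons t (A⁻¹ *ᵥ w - t • (A⁻¹ *ᵥ r)) =
      u 0 * t + w ⬝ᵥ (A⁻¹ *ᵥ w - t • (A⁻¹ *ᵥ r)) := by
    rw [dotProduct, Fin.sum_univ_succ]
    rfl
  rw [hy, hsplit, dotProduct_sub, dotProduct_smul, smul_eq_mul, hsymm, pow_two, mul_div_assoc, ← ht]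
  ring

theorem mvGaussianDensity_eq_mul {m : Fin (n + 1) → ℝ}
    {V : Matrix (Fin (n + 1)) (Fin (n + 1)) ℝ} (hV : V.PosDef) (z : Fin (n + 1) → ℝ) :
    mvGaussianDensity m V z =
      gaussianPDFReal (condMean m V 0 fun j => z j) (condVar V 0).toNNReal (z 0) *
        mvGaussianDensity (m ∘ Fin.succ) (V.submatrix Fin.succ Fin.succ) (z ∘ Fin.succ) := by
  have hs := condVar_pos hV 0
  rw [mvGaussianDensity, mvGaussianDensity, gaussianPDFReal, Real.coe_toNNReal _ hs.le,
    dotProduct_inv_mulVec_eq_add hV, det_eq_det_submatrix_succ_mul_condVar hV, condMean_zero_eq,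
    mul_mul_mul_comm, ← Real.exp_add, ← mul_inv, ← Real.sqrt_mul (by positivity)]
  simp only [Fintype.card_fin]
  congr 1
  · congr 2
    ring
  · have h1 : (fun j : After (0 : Fin (n + 1)) => z j) ∘ afterZeroEquiv n - m ∘ Fin.succ =
        (z - m) ∘ Fin.succ := rfl
    have h2 : z ∘ Fin.succ - m ∘ Fin.succ = (z - m) ∘ Fin.succ := rfl
    rw [h1, h2, Pi.sub_apply]
    congr 1
    field_simp
    ring

end Reindex

/-! ### Basic properties of the densities. -/

theorem continuous_mvGaussianDensity {ι : Type*} [Fintype ι] [DecidableEq ι]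
    (m : ι → ℝ) (V : Matrix ι ι ℝ) : Continuous (mvGaussianDensity m V) := by
  unfold mvGaussianDensity
  fun_prop

theorem mvGaussianDensity_nonneg {ι : Type*} [Fintype ι] [DecidableEq ι]
    (m : ι → ℝ) (V : Matrix ι ι ℝ) (z : ι → ℝ) : 0 ≤ mvGaussianDensity m V z := by
  unfold mvGaussianDensity
  positivity

theorem mvGaussianDensity_fin_one (m : Fin 1 → ℝ) {V : Matrix (Fin 1) (Fin 1) ℝ}
    (hV : V.PosDef) (z : Fin 1 → ℝ) :
    mvGaussianDensity m V z = gaussianPDFReal (m 0) (V 0 0).toNNReal (z 0) := by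
  rw [mvGaussianDensity_eq_mul hV]
  simp [mvGaussianDensity, condMean_zero_eq, condVar_zero_eq, dotProduct]

theorem gaussianIntervalMass_mem_Icc (m v : ℝ) {a b : ℝ} (hab : a ≤ b) :
    gaussianIntervalMass m v a b ∈ Icc (0 : ℝ) 1 := by
  rw [gaussianIntervalMass, intervalIntegral.integral_of_le hab]
  refine ⟨integral_nonneg fun z => gaussianPDFReal_nonneg _ _ z, ?_⟩
  -- For `v ≤ 0` the density is the zero function, so the bound needs no sign condition on `v`.
  rcases eq_or_ne v.toNNReal 0 with h | h
  · simp [h]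
  · rw [← integral_gaussianPDFReal_eq_one m h]
    exact setIntegral_le_integral (integrable_gaussianPDFReal _ _)
      (Filter.Eventually.of_forall fun z => gaussianPDFReal_nonneg _ _ z)

/-! ### Fubini and the bounds for a fixed Gaussian. -/

section BoxBounds

theorem integrableOn_mvGaussianDensity_Icc {ι : Type*} [Fintype ι] [DecidableEq ι]
    (m : ι → ℝ) (V : Matrix ι ι ℝ) (a b : ι → ℝ) :
    IntegrableOn (mvGaussianDensity m V) (Icc a b) :=
  (continuous_mvGaussianDensity m V).continuousOn.integrableOn_compact isCompact_Icc

theorem gaussianIntervalMass_eq_setIntegral (m v : ℝ) {a b : ℝ} (hab : a ≤ b) :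
    gaussianIntervalMass m v a b = ∫ z in Icc a b, gaussianPDFReal m v.toNNReal z := by
  rw [gaussianIntervalMass, intervalIntegral.integral_of_le hab, integral_Icc_eq_integral_Ioc]

theorem setIntegral_mvGaussianDensity_fin_one (m : Fin 1 → ℝ) {V : Matrix (Fin 1) (Fin 1) ℝ}
    (hV : V.PosDef) (a b : Fin 1 → ℝ) (hab : a ≤ b) :
    ∫ z in Icc a b, mvGaussianDensity m V z =
      gaussianIntervalMass (m 0) (V 0 0) (a 0) (b 0) := by
  rw [gaussianIntervalMass_eq_setIntegral _ _ (hab 0)]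
  simp_rw [mvGaussianDensity_fin_one m hV]
  have h := (volume_preserving_funUnique (Fin 1) ℝ).setIntegral_preimage_emb
    (MeasurableEquiv.measurableEmbedding _) (gaussianPDFReal (m 0) (V 0 0).toNNReal)
    (Icc (a 0) (b 0))
  rw [← h]
  congr 2
  ext z
  simp [Pi.le_def]

variable {n : ℕ}

/-- Integrating out the first coordinate of a Gaussian over a box. -/
theorem integral_gaussianIntervalMass_mul {m : Fin (n + 1) → ℝ}
    {V : Matrix (Fin (n + 1)) (Fin (n + 1)) ℝ} (hV : V.PosDef) {a b : Fin (n + 1) → ℝ}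
    (hab : a ≤ b) :
    IntegrableOn (fun w : Fin n → ℝ =>
        gaussianIntervalMass (condMean m V 0 (w ∘ (afterZeroEquiv n).symm)) (condVar V 0) (a 0) (b 0) *
          mvGaussianDensity (m ∘ Fin.succ) (V.submatrix Fin.succ Fin.succ) w)
        (Icc (a ∘ Fin.succ) (b ∘ Fin.succ)) ∧
    ∫ z in Icc a b, mvGaussianDensity m V z =
      ∫ w in Icc (a ∘ Fin.succ) (b ∘ Fin.succ),
        gaussianIntervalMass (condMean m V 0 (w ∘ (afterZeroEquiv n).symm)) (condVar V 0) (a 0) (b 0) *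
          mvGaussianDensity (m ∘ Fin.succ) (V.submatrix Fin.succ Fin.succ) w := by
  let e := MeasurableEquiv.piFinSuccAbove (fun _ : Fin (n + 1) => ℝ) 0
  have hmp : MeasurePreserving e := volume_preserving_piFinSuccAbove (fun _ => ℝ) 0
  let F : ℝ × (Fin n → ℝ) → ℝ := fun p =>
    gaussianPDFReal (condMean m V 0 (p.2 ∘ (afterZeroEquiv n).symm)) (condVar V 0).toNNReal p.1 *
      mvGaussianDensity (m ∘ Fin.succ) (V.submatrix Fin.succ Fin.succ) p.2
  have hF : ∀ z, F (e z) = mvGaussianDensity m V z := fun z => by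
    rw [mvGaussianDensity_eq_mul hV]
    have h : (e z).2 ∘ (afterZeroEquiv n).symm = fun j : After (0 : Fin (n + 1)) => z j := by
      ext j
      exact congrArg z (Fin.succ_pred j.1 j.2.ne')
    simp only [F, h]
    rfl
  have hpre : e ⁻¹' (Icc (a 0) (b 0) ×ˢ Icc (a ∘ Fin.succ) (b ∘ Fin.succ)) = Icc a b := by
    ext z
    simp only [mem_preimage, mem_prod, mem_Icc, Pi.le_def, Fin.forall_fin_succ (P := fun i => a i ≤ z i),
      Fin.forall_fin_succ (P := fun i => z i ≤ b i)]
    exact and_and_and_comm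
  -- Integrability is transported through `e` from the joint density, which is continuous on a
  -- compact box.
  have hint : Integrable F ((volume.restrict (Icc (a 0) (b 0))).prod
      (volume.restrict (Icc (a ∘ Fin.succ) (b ∘ Fin.succ)))) := by
    rw [Measure.prod_restrict]
    have := (hmp.integrableOn_comp_preimage e.measurableEmbedding (f := F)
      (s := Icc (a 0) (b 0) ×ˢ Icc (a ∘ Fin.succ) (b ∘ Fin.succ))).1
    refine this ?_
    rw [hpre, show F ∘ e = mvGaussianDensity m V from funext hF]
    exact integrableOn_mvGaussianDensity_Icc m V a b
  have hinner : ∀ w, ∫ t in Icc (a 0) (b 0), F (t, w) =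
      gaussianIntervalMass (condMean m V 0 (w ∘ (afterZeroEquiv n).symm)) (condVar V 0) (a 0) (b 0) *
        mvGaussianDensity (m ∘ Fin.succ) (V.submatrix Fin.succ Fin.succ) w := fun w => by
    rw [gaussianIntervalMass_eq_setIntegral _ _ (hab 0), ← integral_mul_const]
  simp_rw [← hinner, ← hF]
  refine ⟨hint.integral_prod_right, ?_⟩
  rw [← hpre, hmp.setIntegral_preimage_emb e.measurableEmbedding F, ← integral_prod_symm F hint,
    Measure.prod_restrict]
  rfl

/-- Bounds on the conditional masses give a bound on the mass of a box. -/
theorem setIntegral_mvGaussianDensity_mem_Icc {m : Fin (n + 1) → ℝ}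
    {V : Matrix (Fin (n + 1)) (Fin (n + 1)) ℝ} (hV : V.PosDef) {a b : Fin (n + 1) → ℝ}
    (hab : a ≤ b) {l u : Fin n → ℝ} (hl : ∀ i, 0 ≤ l i)
    (h : ∀ i : Fin n, ∀ f ∈ tailBox a b i.castSucc,
      gaussianIntervalMass (condMean m V i.castSucc f) (condVar V i.castSucc)
        (a i.castSucc) (b i.castSucc) ∈ Icc (l i) (u i)) :
    ∫ z in Icc a b, mvGaussianDensity m V z ∈
      Icc (gaussianIntervalMass (m (Fin.last n)) (V (Fin.last n) (Fin.last n))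
          (a (Fin.last n)) (b (Fin.last n)) * ∏ i, l i)
        (gaussianIntervalMass (m (Fin.last n)) (V (Fin.last n) (Fin.last n))
          (a (Fin.last n)) (b (Fin.last n)) * ∏ i, u i) := by
  induction n with
  | zero => simp [setIntegral_mvGaussianDensity_fin_one m hV a b hab]
  | succ n ih =>
    have ih' := ih (m := m ∘ Fin.succ) (hV.submatrix (Fin.succ_injective _))
      (a := a ∘ Fin.succ) (b := b ∘ Fin.succ) (fun j => hab j.succ) (l := l ∘ Fin.succ)
      (u := u ∘ Fin.succ) (fun i => hl i.succ) fun i f hf => by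
        have hf' : f ∘ (afterSuccEquiv i.castSucc).symm ∈ tailBox a b i.succ.castSucc := by
          constructor
          · intro j
            obtain ⟨j, rfl⟩ := (afterSuccEquiv i.castSucc).surjective j
            exact (hf.1 j).trans_eq (congrArg f ((afterSuccEquiv i.castSucc).symm_apply_apply j).symm)
          · intro j
            obtain ⟨j, rfl⟩ := (afterSuccEquiv i.castSucc).surjective j
            exact (congrArg f ((afterSuccEquiv i.castSucc).symm_apply_apply j)).trans_le (hf.2 j)
        have := h i.succ _ hf'
        change gaussianIntervalMass (condMean m V i.castSucc.succ _) (condVar V i.castSucc.succ)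
          (a i.castSucc.succ) (b i.castSucc.succ) ∈ _ at this
        rw [condMean_succ, condVar_succ] at this
        simpa [Function.comp_assoc] using this
    obtain ⟨hint, heq⟩ := integral_gaussianIntervalMass_mul (m := m) hV hab
    have hd := integrableOn_mvGaussianDensity_Icc (m ∘ Fin.succ)
      (V.submatrix Fin.succ Fin.succ) (a ∘ Fin.succ) (b ∘ Fin.succ)
    have h0 : ∀ w ∈ Icc (a ∘ Fin.succ) (b ∘ Fin.succ),
        gaussianIntervalMass (condMean m V 0 (w ∘ (afterZeroEquiv (n + 1)).symm)) (condVar V 0)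
          (a 0) (b 0) ∈ Icc (l 0) (u 0) := fun w hw => by
      refine h 0 _ ⟨fun j => ?_, fun j => ?_⟩
      · obtain ⟨j, rfl⟩ := (afterZeroEquiv (n + 1)).surjective j
        exact (hw.1 j).trans_eq (congrArg w ((afterZeroEquiv (n + 1)).symm_apply_apply j).symm)
      · obtain ⟨j, rfl⟩ := (afterZeroEquiv (n + 1)).surjective j
        exact (congrArg w ((afterZeroEquiv (n + 1)).symm_apply_apply j)).trans_le (hw.2 j)
    -- The tail box is nonempty, so some conditional mass lies between `l 0 ≥ 0` and `u 0`.
    have hu0 : 0 ≤ u 0 := by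
      have := h0 (a ∘ Fin.succ) (left_mem_Icc.2 fun j => hab j.succ)
      exact (hl 0).trans (this.1.trans this.2)
    rw [heq, Fin.prod_univ_succ, Fin.prod_univ_succ, mul_left_comm, mul_left_comm _ (u 0)]
    constructor
    · refine (mul_le_mul_of_nonneg_left ih'.1 (hl 0)).trans ?_
      rw [← integral_const_mul]
      exact setIntegral_mono_on (hd.const_mul _) hint measurableSet_Icc fun w hw =>
        mul_le_mul_of_nonneg_right (h0 w hw).1 (mvGaussianDensity_nonneg _ _ _)
    · refine le_trans ?_ (mul_le_mul_of_nonneg_left ih'.2 hu0)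
      rw [← integral_const_mul]
      exact setIntegral_mono_on hint (hd.const_mul _) measurableSet_Icc fun w hw =>
        mul_le_mul_of_nonneg_right (h0 w hw).2 (mvGaussianDensity_nonneg _ _ _)

theorem setIntegral_mvGaussianDensity_mem_unitInterval {m : Fin (n + 1) → ℝ}
    {V : Matrix (Fin (n + 1)) (Fin (n + 1)) ℝ} (hV : V.PosDef) {a b : Fin (n + 1) → ℝ}
    (hab : a ≤ b) : ∫ z in Icc a b, mvGaussianDensity m V z ∈ Icc (0 : ℝ) 1 := by
  refine ⟨integral_nonneg fun z => mvGaussianDensity_nonneg _ _ _, ?_⟩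
  -- With these trivial bounds the box mass is at most the mass of the last marginal, so the total
  -- integral of the joint density is not needed.
  have h := (setIntegral_mvGaussianDensity_mem_Icc (m := m) hV hab (l := 0) (u := 1) (fun _ => le_rfl)
    fun i f _ => gaussianIntervalMass_mem_Icc _ _ (hab _)).2
  simp only [Pi.one_apply, Finset.prod_const_one, mul_one] at h
  exact h.trans (gaussianIntervalMass_mem_Icc _ _ (hab _)).2

end BoxBounds

/-! ### Continuity in the parameters. -/

section Continuity

variable {X : Type*} [TopologicalSpace X]

theorem Continuous.matrix_inv_of_det_ne_zero {ι : Type*} [Fintype ι] [DecidableEq ι]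
    {A : X → Matrix ι ι ℝ} (hA : Continuous A) (h : ∀ x, (A x).det ≠ 0) :
    Continuous fun x => (A x)⁻¹ := by
  simp_rw [inv_def, Ring.inverse_eq_inv]
  exact (hA.matrix_det.inv₀ h).smul hA.matrix_adjugate

theorem continuous_gaussianIntervalMass [FirstCountableTopology X] [LocallyCompactSpace X]
    {m v : X → ℝ} (hm : Continuous m) (hv : Continuous v) (hpos : ∀ x, 0 < v x) {a b : ℝ}
    (hab : a ≤ b) : Continuous fun x => gaussianIntervalMass (m x) (v x) a b := by
  simp_rw [gaussianIntervalMass_eq_setIntegral _ _ hab]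
  refine continuous_parametric_integral_of_continuous ?_ isCompact_Icc
  have h1 : ∀ p : X × ℝ, √(2 * Real.pi * v p.1) ≠ 0 := fun p =>
    (Real.sqrt_pos.2 (mul_pos (by positivity) (hpos p.1))).ne'
  have h2 : ∀ p : X × ℝ, 2 * v p.1 ≠ 0 := fun p => (mul_pos two_pos (hpos p.1)).ne'
  simp only [Function.uncurry_def, gaussianPDFReal, Real.coe_toNNReal _ (hpos _).le]
  fun_prop (disch := assumption)

theorem continuous_setIntegral_mvGaussianDensity [FirstCountableTopology X]
    [LocallyCompactSpace X] {ι : Type*} [Fintype ι] [DecidableEq ι]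
    {m : X → ι → ℝ} {V : X → Matrix ι ι ℝ} (hm : Continuous m) (hV : Continuous V)
    (hpos : ∀ x, (V x).PosDef) (a b : ι → ℝ) :
    Continuous fun x => ∫ z in Icc a b, mvGaussianDensity (m x) (V x) z := by
  refine continuous_parametric_integral_of_continuous ?_ isCompact_Icc
  have h1 : ∀ p : X × (ι → ℝ), √((2 * Real.pi) ^ Fintype.card ι * (V p.1).det) ≠ 0 := fun p =>
    (Real.sqrt_pos.2 (mul_pos (by positivity) (hpos p.1).det_pos)).ne'
  have hinv := hV.matrix_inv_of_det_ne_zero fun x => (hpos x).det_pos.ne'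
  have hsub : Continuous fun p : X × (ι → ℝ) => p.2 - m p.1 := by fun_prop
  have hq := hsub.dotProduct ((hinv.comp continuous_fst).matrix_mulVec hsub)
  have hdet : Continuous fun p : X × (ι → ℝ) => (V p.1).det :=
    (hV.comp continuous_fst).matrix_det
  exact ((continuous_const.mul hdet).sqrt.inv₀ h1).mul
    (Real.continuous_exp.comp (hq.neg.div_const 2))

theorem continuous_condVar {C : ℕ} {V : X → Matrix (Fin C) (Fin C) ℝ} (hV : Continuous V)
    (hpos : ∀ x, (V x).PosDef) (i : Fin C) : Continuous fun x => condVar (V x) i := by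
  have hblock : Continuous fun x => tailBlock (V x) i := hV.matrix_submatrix _ _
  have hinv := hblock.matrix_inv_of_det_ne_zero fun x =>
    ((hpos x).submatrix Subtype.val_injective).det_pos.ne'
  have hrow : Continuous fun x => tailRow (V x) i :=
    continuous_pi fun j => hV.matrix_elem i j
  exact (hV.matrix_elem i i).sub (hrow.dotProduct (hinv.matrix_mulVec hrow))

theorem continuous_condMean {C : ℕ} {m : X → Fin C → ℝ} {V : X → Matrix (Fin C) (Fin C) ℝ}
    {i : Fin C} {f : X → After i → ℝ} (hm : Continuous m) (hV : Continuous V)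
    (hf : Continuous f) (hpos : ∀ x, (V x).PosDef) :
    Continuous fun x => condMean (m x) (V x) i (f x) := by
  have hblock : Continuous fun x => tailBlock (V x) i := hV.matrix_submatrix _ _
  have hinv := hblock.matrix_inv_of_det_ne_zero fun x =>
    ((hpos x).submatrix Subtype.val_injective).det_pos.ne'
  have hrow : Continuous fun x => tailRow (V x) i :=
    continuous_pi fun j => hV.matrix_elem i j
  have htail : Continuous fun x => tailVec (m x) i :=
    continuous_pi fun j => (continuous_apply j.1).comp hm
  exact ((continuous_apply i).comp hm).add (hrow.dotProduct (hinv.matrix_mulVec (hf.sub htail)))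

end Continuity

/-! ### Continuity of the masses on a compact `T`. -/

section Masses

variable {d n : ℕ} {T : Set (EuclideanSpace ℝ (Fin d))}
  {μ : EuclideanSpace ℝ (Fin d) → Fin (n + 1) → ℝ}
  {cov : EuclideanSpace ℝ (Fin d) → Matrix (Fin (n + 1)) (Fin (n + 1)) ℝ}
  {k₁ k₂ : Fin (n + 1) → ℝ}

theorem continuousOn_boxMass (hcov : ∀ x ∈ T, (cov x).PosDef) (hT : IsCompact T)
    (hμ : ContinuousOn μ T) (hc : ContinuousOn cov T) :
    ContinuousOn (boxMass μ cov k₁ k₂) T := by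
  -- Positive definiteness is known only on `T`, so `T` itself becomes the parameter space; its
  -- compactness supplies the local compactness needed for the parametric integral.
  have := isCompact_iff_compactSpace.1 hT
  rw [continuousOn_iff_continuous_domRestrict] at hμ hc ⊢
  exact continuous_setIntegral_mvGaussianDensity hμ hc (fun x => hcov x x.2) k₁ k₂

theorem continuousOn_lastMass (hcov : ∀ x ∈ T, (cov x).PosDef) (hk : k₁ ≤ k₂) (hT : IsCompact T)
    (hμ : ContinuousOn μ T) (hc : ContinuousOn cov T) :
    ContinuousOn (lastMass μ cov k₁ k₂) T := by
  have := isCompact_iff_compactSpace.1 hT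
  rw [continuousOn_iff_continuous_domRestrict] at hμ hc ⊢
  exact continuous_gaussianIntervalMass ((continuous_apply (Fin.last n)).comp hμ)
    (hc.matrix_elem (Fin.last n) (Fin.last n)) (fun x => (hcov x x.2).diag_pos) (hk _)

theorem continuousOn_condMass (hcov : ∀ x ∈ T, (cov x).PosDef) (hk : k₁ ≤ k₂) (hT : IsCompact T)
    (hμ : ContinuousOn μ T) (hc : ContinuousOn cov T) (i : Fin (n + 1)) :
    ContinuousOn (condMass μ cov k₁ k₂ i) (T ×ˢ tailBox k₁ k₂ i) := by
  have hS : IsCompact (T ×ˢ tailBox k₁ k₂ i) := hT.prod isCompact_Icc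
  have := isCompact_iff_compactSpace.1 hS
  have hμ' := hμ.comp continuousOn_fst (fun p hp => hp.1 : MapsTo _ (T ×ˢ tailBox k₁ k₂ i) T)
  have hc' := hc.comp continuousOn_fst (fun p hp => hp.1 : MapsTo _ (T ×ˢ tailBox k₁ k₂ i) T)
  rw [continuousOn_iff_continuous_domRestrict] at hμ' hc' ⊢
  have hpos : ∀ p : ↥(T ×ˢ tailBox k₁ k₂ i), (cov p.1.1).PosDef := fun p => hcov _ p.2.1
  exact continuous_gaussianIntervalMass
    (continuous_condMean hμ' hc' (continuous_snd.comp continuous_subtype_val) hpos)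
    (continuous_condVar hc' hpos i) (fun p => condVar_pos (hpos p) i) (hk i)

end Masses

theorem proposition4 {d n : ℕ}
    (T : Set (EuclideanSpace ℝ (Fin d))) (hT : T.Nonempty)
    (μ : EuclideanSpace ℝ (Fin d) → Fin (n + 1) → ℝ)
    (cov : EuclideanSpace ℝ (Fin d) → Matrix (Fin (n + 1)) (Fin (n + 1)) ℝ)
    (hcov : ∀ x ∈ T, (cov x).PosDef)
    (k₁ k₂ : Fin (n + 1) → ℝ) (hk : ∀ i, k₁ i ≤ k₂ i) :
    -- the upper bound
    (sSup (boxMass μ cov k₁ k₂ '' T) ≤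
      sSup (lastMass μ cov k₁ k₂ '' T) *
        ∏ i : Fin n, sSup (condMass μ cov k₁ k₂ i.castSucc '' (T ×ˢ tailBox k₁ k₂ i.castSucc))) ∧
    -- the lower bound
    (sInf (lastMass μ cov k₁ k₂ '' T) *
        ∏ i : Fin n, sInf (condMass μ cov k₁ k₂ i.castSucc '' (T ×ˢ tailBox k₁ k₂ i.castSucc)) ≤
      sInf (boxMass μ cov k₁ k₂ '' T)) ∧
    -- every quantity optimised is a number in `[0, 1]`, so these are genuine suprema and infima
    ((∀ x ∈ T, boxMass μ cov k₁ k₂ x ∈ Set.Icc 0 1 ∧ lastMass μ cov k₁ k₂ x ∈ Set.Icc 0 1) ∧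
      ∀ i : Fin n, ∀ p ∈ T ×ˢ tailBox k₁ k₂ i.castSucc,
        condMass μ cov k₁ k₂ i.castSucc p ∈ Set.Icc 0 1) ∧
    -- for a compact `T` and `μ`, `Σ` continuous on `T`, they are maxima and minima
    (IsCompact T → ContinuousOn μ T → ContinuousOn cov T →
      (∃ x ∈ T, IsMaxOn (boxMass μ cov k₁ k₂) T x) ∧
      (∃ x ∈ T, IsMinOn (boxMass μ cov k₁ k₂) T x) ∧
      (∃ x ∈ T, IsMaxOn (lastMass μ cov k₁ k₂) T x) ∧
      (∃ x ∈ T, IsMinOn (lastMass μ cov k₁ k₂) T x) ∧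
      ∀ i : Fin n,
        (∃ p ∈ T ×ˢ tailBox k₁ k₂ i.castSucc,
          IsMaxOn (condMass μ cov k₁ k₂ i.castSucc) (T ×ˢ tailBox k₁ k₂ i.castSucc) p) ∧
        (∃ p ∈ T ×ˢ tailBox k₁ k₂ i.castSucc,
          IsMinOn (condMass μ cov k₁ k₂ i.castSucc) (T ×ˢ tailBox k₁ k₂ i.castSucc) p)) := by
  have hlast : ∀ x, lastMass μ cov k₁ k₂ x ∈ Icc (0 : ℝ) 1 := fun x =>
    gaussianIntervalMass_mem_Icc _ _ (hk _)
  have hcond : ∀ i p, condMass μ cov k₁ k₂ i p ∈ Icc (0 : ℝ) 1 := fun i p =>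
    gaussianIntervalMass_mem_Icc _ _ (hk _)
  have hne : ∀ i : Fin (n + 1), (T ×ˢ tailBox k₁ k₂ i).Nonempty := fun i =>
    hT.prod (nonempty_Icc.2 fun j => hk j)
  have hbdd : ∀ {α : Type} {g : α → ℝ} (s : Set α), (∀ y, g y ∈ Icc (0 : ℝ) 1) →
      BddAbove (g '' s) ∧ BddBelow (g '' s) := fun s hg =>
    ⟨⟨1, forall_mem_image.2 fun y _ => (hg y).2⟩, ⟨0, forall_mem_image.2 fun y _ => (hg y).1⟩⟩
  have hinf : ∀ i : Fin n,
      0 ≤ sInf (condMass μ cov k₁ k₂ i.castSucc '' (T ×ˢ tailBox k₁ k₂ i.castSucc)) := fun i =>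
    Real.sInf_nonneg (forall_mem_image.2 fun p _ => (hcond _ p).1)
  have hsup : ∀ i : Fin n,
      0 ≤ sSup (condMass μ cov k₁ k₂ i.castSucc '' (T ×ˢ tailBox k₁ k₂ i.castSucc)) := fun i =>
    Real.sSup_nonneg (forall_mem_image.2 fun p _ => (hcond _ p).1)
  -- The fixed-`x` bound is applied with constants already extremised over all of `T`, so only the
  -- factor `lastMass` still depends on `x`.
  have hbox : ∀ x ∈ T, boxMass μ cov k₁ k₂ x ∈ Icc
      (lastMass μ cov k₁ k₂ x *
        ∏ i : Fin n, sInf (condMass μ cov k₁ k₂ i.castSucc '' (T ×ˢ tailBox k₁ k₂ i.castSucc)))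
      (lastMass μ cov k₁ k₂ x *
        ∏ i : Fin n, sSup (condMass μ cov k₁ k₂ i.castSucc '' (T ×ˢ tailBox k₁ k₂ i.castSucc))) :=
    fun x hx => setIntegral_mvGaussianDensity_mem_Icc (hcov x hx) hk hinf fun i f hf =>
      ⟨csInf_le (hbdd _ (hcond i.castSucc)).2 (mem_image_of_mem _ (mk_mem_prod hx hf)),
        le_csSup (hbdd _ (hcond i.castSucc)).1 (mem_image_of_mem _ (mk_mem_prod hx hf))⟩
  refine ⟨?_, ?_, ⟨fun x hx => ⟨?_, hlast x⟩, fun i p _ => hcond _ p⟩, fun hc hμ hcov' => ?_⟩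
  · refine csSup_le (hT.image _) (forall_mem_image.2 fun x hx => (hbox x hx).2.trans ?_)
    exact mul_le_mul_of_nonneg_right (le_csSup (hbdd _ hlast).1 (mem_image_of_mem _ hx))
      (Finset.prod_nonneg fun i _ => hsup i)
  · refine le_csInf (hT.image _) (forall_mem_image.2 fun x hx => le_trans ?_ (hbox x hx).1)
    exact mul_le_mul_of_nonneg_right (csInf_le (hbdd _ hlast).2 (mem_image_of_mem _ hx))
      (Finset.prod_nonneg fun i _ => hinf i)
  · exact setIntegral_mvGaussianDensity_mem_unitInterval (hcov x hx) hk
  · have h1 := continuousOn_boxMass (k₁ := k₁) (k₂ := k₂) hcov hc hμ hcov'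
    have h2 := continuousOn_lastMass hcov hk hc hμ hcov'
    have h3 := continuousOn_condMass hcov hk hc hμ hcov'
    have hS : ∀ i, IsCompact (T ×ˢ tailBox k₁ k₂ i) := fun i => hc.prod isCompact_Icc
    exact ⟨hc.exists_isMaxOn hT h1, hc.exists_isMinOn hT h1, hc.exists_isMaxOn hT h2,
      hc.exists_isMinOn hT h2, fun i => ⟨(hS _).exists_isMaxOn (hne _) (h3 _),
        (hS _).exists_isMinOn (hne _) (h3 _)⟩⟩
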